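/- Let $\mathbb T=\mathbb R/\mathbb Z$, and write $|x-y|$ for the distance on $\mathbb T$. There exists a universal constant $C>0$ such that the following holds. Let $M\ge 128$ be an integer, let $J$ be a natural number, and let $s_1,\dots,s_J\in\mathbb T$ satisfy $|s_j-s_k|\ge 2/M$ for all $j\ne k$. Then for all $a,b\in\mathbb C^J$ there exists a trigonometric polynomial $f(x)=\sum_{m=-M}^{M}c_m e^{2\pi i m x}$ with $c_m\in\mathbb C$ such that $$\|f\|_{L^\infty(\mathbb T)}\le C\big(\|a\|_\infty+M^{-1}\|b\|_\infty\big),$$ and, for every $j\in\{1,\dots,J\}$ and every $x\in\mathbb T$ with $|x-s_j|\le 0.16\,M^{-1}$, $$|f(x)-a_j-b_j(x-s_j)|\le C\big(M^2\|a\|_\infty+M\|b\|_\infty\big)|x-s_j|^2.$$ Here $\|v\|_\infty=\max_j|v_j|$ for $v\in\mathbb C^J$, and in the term $b_j(x-s_j)$ the difference $x-s_j$ denotes its real representative in $(-\tfrac12,\tfrac12]$. -/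

import Mathlib

noncomputable section

/-- The trigonometric polynomials of degree (at most) `M` on the torus `ℝ/ℤ`; here
`fourier m x = exp (2πi m x)`. -/
def trigPoly (M : ℕ) : Set C(UnitAddCircle, ℂ) :=
  {f | ∃ c : ℤ → ℂ, ∀ x : UnitAddCircle,
    f x = ∑ m ∈ Finset.Icc (-(M : ℤ)) (M : ℤ), c m * fourier m x}

/-- The minimum separation condition: distinct indices give points whose distance on the torus
is at least `2 / M`. -/
def MinSeparation (M : ℕ) {J : ℕ} (s : Fin J → UnitAddCircle) : Prop :=
  ∀ j k : Fin J, j ≠ k → 2 / (M : ℝ) ≤ dist (s j) (s k)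

/-- The closed neighbourhood of radius `0.16 / M` of the `j`-th point. -/
def nbhd (M : ℕ) {J : ℕ} (s : Fin J → UnitAddCircle) (j : Fin J) : Set UnitAddCircle :=
  {x | dist x (s j) ≤ 0.16 / (M : ℝ)}

/-- The representative in `(-1/2, 1/2]` of a point of the torus. It gives a meaning to
the real number `x - s` for points `x`, `s` of the torus that are close to each other. -/
def signedRep (x : UnitAddCircle) : ℝ :=
  (AddCircle.equivIoc (1 : ℝ) (-(1 / 2)) x : ℝ)

end

/-!
The squared Dirichlet kernels `K_N(x - s_k)`, with `N ≈ 0.46 M`, decay quadratically, so on a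
`2 / M`-separated set their interpolation matrix is diagonally dominant (this is where
`ζ(2) = π² / 6` enters) and there are Lagrange polynomials `G_j` of degree `< N`, bounded by an
absolute constant. The bump `P_j = G_j² K_n(x - s_j)`, with `n ≈ 0.02 M`, has double zeros at the
other points, and multiplying it by a combination of `1` and `(e(n (x - s_j)) - 1) / (2 π i n)`
prescribes the value and the derivative at `s_j`. Because of the factor `K_n(x - s_j)` the sum over
`j` is still bounded by an absolute constant times the size of the data. The remainder estimate is
Taylor's formula together with Bernstein's inequality, for which a trigonometric polynomial is
regarded as an entire function of exponential type: Phragmén–Lindelöf gives its growth off the real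
axis from its supremum on the real axis, and Cauchy's estimates give its derivatives.
-/

open Real Finset

section EntireFunctions

variable {E : Type*} [NormedAddCommGroup E] [NormedSpace ℂ E] {F : ℂ → E} {σ B K : ℝ}

theorem norm_le_mul_exp_im_of_im_nonneg (hF : Differentiable ℂ F)
    (hK : ∀ z, ‖F z‖ ≤ K * exp (σ * |z.im|)) (hB : ∀ t : ℝ, ‖F t‖ ≤ B) {z : ℂ} (hz : 0 ≤ z.im) :
    ‖F z‖ ≤ B * exp (σ * z.im) := by
  -- `w ↦ exp (-σ w) F (i w)` is bounded for `0 ≤ w.re`, so Phragmén–Lindelöf applies to it.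
  let G : ℂ → E := fun w ↦ Complex.exp (-(σ * w)) • F (Complex.I * w)
  have hG_norm (w : ℂ) : ‖G w‖ = exp (-(σ * w.re)) * ‖F (Complex.I * w)‖ := by
    simp only [G, norm_smul, Complex.norm_exp, Complex.neg_re, Complex.re_ofReal_mul]
  have hG_le {w : ℂ} (hw : 0 ≤ w.re) : ‖G w‖ ≤ K := by
    have h := hK (Complex.I * w)
    rw [Complex.I_mul_im, abs_of_nonneg hw, ← div_le_iff₀ (exp_pos _), div_eq_inv_mul,
      ← exp_neg] at h
    rwa [hG_norm]
  have hG_axis (y : ℝ) : ‖G (y * Complex.I)‖ ≤ B := by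
    have hy : Complex.I * (y * Complex.I) = ((-y : ℝ) : ℂ) := by
      rw [mul_left_comm, Complex.I_mul_I, Complex.ofReal_neg, mul_neg_one]
    simpa [hG_norm, hy] using hB (-y)
  have hG_diff : Differentiable ℂ G := by fun_prop
  have key : ‖G (-Complex.I * z)‖ ≤ B := by
    refine PhragmenLindelof.right_half_plane_of_bounded_on_real hG_diff.diffContOnCl
      ⟨0, two_pos, 0, ?_⟩ ?_ hG_axis (by simpa using hz)
    · refine Asymptotics.IsBigO.of_bound K (Filter.eventually_inf_principal.2 (.of_forall ?_))
      intro w hw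
      simpa using hG_le (le_of_lt hw)
    · exact Filter.isBoundedUnder_of_eventually_le
        ((Filter.eventually_ge_atTop 0).mono fun x hx ↦ hG_le (by simpa using hx))
  rw [hG_norm, ← mul_assoc, mul_neg, Complex.I_mul_I, neg_neg, one_mul] at key
  simpa [exp_neg, ← div_eq_inv_mul, div_le_iff₀ (exp_pos _)] using key

theorem norm_le_mul_exp_abs_im (hF : Differentiable ℂ F)
    (hK : ∀ z, ‖F z‖ ≤ K * exp (σ * |z.im|)) (hB : ∀ t : ℝ, ‖F t‖ ≤ B) (z : ℂ) :
    ‖F z‖ ≤ B * exp (σ * |z.im|) := by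
  rcases le_total 0 z.im with hz | hz
  · rw [abs_of_nonneg hz]
    exact norm_le_mul_exp_im_of_im_nonneg hF hK hB hz
  · rw [abs_of_nonpos hz]
    have hF' : Differentiable ℂ fun w ↦ F (-w) := by fun_prop
    simpa using norm_le_mul_exp_im_of_im_nonneg hF' (fun w ↦ by simpa using hK (-w))
      (fun t ↦ by simpa using hB (-t)) (z := -z) (by simpa using hz)

/-- A weak form of Bernstein's inequality, by Cauchy's estimate on discs of radius `σ⁻¹`. -/
theorem norm_iteratedDeriv_ofReal_le [CompleteSpace E] (hF : Differentiable ℂ F) (hσ : 0 < σ)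
    (hB : ∀ z, ‖F z‖ ≤ B * exp (σ * |z.im|)) (n : ℕ) (t : ℝ) :
    ‖iteratedDeriv n F t‖ ≤ n.factorial * (B * exp 1) * σ ^ n := by
  have hB0 : 0 ≤ B := by simpa using (norm_nonneg _).trans (hB 0)
  have hsphere : ∀ z ∈ Metric.sphere (t : ℂ) σ⁻¹, ‖F z‖ ≤ B * exp 1 := by
    intro z hz
    have him : |z.im| ≤ σ⁻¹ := by
      simpa [← mem_sphere_iff_norm.1 hz] using Complex.abs_im_le_norm (z - t)
    refine (hB z).trans ?_
    gcongr
    simpa [hσ.ne'] using mul_le_mul_of_nonneg_left him hσ.le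
  have h := Complex.norm_iteratedDeriv_le_of_forall_mem_sphere_norm_le n (inv_pos.2 hσ)
    hF.diffContOnCl hsphere
  rwa [inv_pow, div_inv_eq_mul] at h

end EntireFunctions

theorem norm_sub_sub_smul_le_mul_sq {E : Type*} [NormedAddCommGroup E] [NormedSpace ℝ E]
    {u u' u'' : ℝ → E} {S : ℝ} (hu : ∀ t, HasDerivAt u (u' t) t)
    (hu' : ∀ t, HasDerivAt u' (u'' t) t) (hS : ∀ t, ‖u'' t‖ ≤ S) (t₀ t : ℝ) :
    ‖u t - u t₀ - (t - t₀) • u' t₀‖ ≤ S * (t - t₀) ^ 2 := by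
  have hS0 : 0 ≤ S := (norm_nonneg _).trans (hS 0)
  have hu'_lip (r : ℝ) : ‖u' r - u' t₀‖ ≤ S * ‖r - t₀‖ :=
    convex_univ.norm_image_sub_le_of_norm_hasDerivWithin_le
      (fun x _ ↦ (hu' x).hasDerivWithinAt) (fun x _ ↦ hS x) (Set.mem_univ _) (Set.mem_univ _)
  let v : ℝ → E := fun r ↦ u r - (r - t₀) • u' t₀
  have hv (r : ℝ) : HasDerivAt v (u' r - u' t₀) r := by
    simpa using! (hu r).sub (((hasDerivAt_id r).sub_const t₀).smul_const (u' t₀))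
  have hv_deriv_le : ∀ r ∈ Metric.closedBall t₀ |t - t₀|, ‖u' r - u' t₀‖ ≤ S * |t - t₀| := by
    intro r hr
    refine (hu'_lip r).trans ?_
    rw [mem_closedBall_iff_norm] at hr
    gcongr
  have h : ‖v t - v t₀‖ ≤ S * |t - t₀| * ‖t - t₀‖ :=
    (convex_closedBall t₀ |t - t₀|).norm_image_sub_le_of_norm_hasDerivWithin_le
      (fun r _ ↦ (hv r).hasDerivWithinAt) hv_deriv_le
      (Metric.mem_closedBall_self (abs_nonneg _)) (by simp [Real.dist_eq])
  calc ‖u t - u t₀ - (t - t₀) • u' t₀‖ = ‖v t - v t₀‖ := by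
        simp only [v, sub_self, zero_smul, sub_zero, sub_right_comm]
    _ ≤ S * |t - t₀| * ‖t - t₀‖ := h
    _ = S * (t - t₀) ^ 2 := by rw [Real.norm_eq_abs, mul_assoc, ← pow_two, sq_abs]

section TrigonometricPolynomials

/-- `trigPoly L` as a submodule, which gives access to closure under linear combinations. -/
noncomputable def trigSubmodule (L : ℕ) : Submodule ℂ C(UnitAddCircle, ℂ) :=
  Submodule.span ℂ ((fun m : ℤ ↦ fourier m) '' (Icc (-(L : ℤ)) L : Finset ℤ))

theorem mem_trigSubmodule_iff {L : ℕ} {f : C(UnitAddCircle, ℂ)} :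
    f ∈ trigSubmodule L ↔ f ∈ trigPoly L := by
  rw [trigSubmodule, Submodule.mem_span_image_finset_iff_exists_fun']
  refine exists_congr fun c ↦ ?_
  rw [ContinuousMap.ext_iff]
  refine forall_congr' fun x ↦ ?_
  rw [eq_comm, ContinuousMap.sum_apply]
  rfl

variable {L L' : ℕ} {f g : C(UnitAddCircle, ℂ)}

theorem fourier_mem_trigSubmodule {m : ℤ} (hm : |m| ≤ L) : fourier m ∈ trigSubmodule L :=
  Submodule.subset_span ⟨m, by simpa [abs_le] using hm, rfl⟩

theorem one_mem_trigSubmodule (L : ℕ) : 1 ∈ trigSubmodule L := by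
  rw [show (1 : C(UnitAddCircle, ℂ)) = fourier 0 by ext; simp]
  exact fourier_mem_trigSubmodule (by simp)

theorem trigSubmodule_mono (h : L ≤ L') : trigSubmodule L ≤ trigSubmodule L' := by
  unfold trigSubmodule
  gcongr

theorem mul_mem_trigSubmodule (hf : f ∈ trigSubmodule L) (hg : g ∈ trigSubmodule L') :
    f * g ∈ trigSubmodule (L + L') := by
  have hmul : trigSubmodule L * trigSubmodule L' ≤ trigSubmodule (L + L') := by
    rw [trigSubmodule, trigSubmodule, Submodule.span_mul_span, Submodule.span_le]
    rintro _ ⟨_, ⟨m, hm, rfl⟩, _, ⟨n, hn, rfl⟩, rfl⟩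
    have hmn : fourier m * fourier n = (fourier (m + n) : C(UnitAddCircle, ℂ)) := by
      ext x
      exact fourier_add.symm
    simp only [coe_Icc, Set.mem_Icc] at hm hn
    simp only [hmn, SetLike.mem_coe]
    exact fourier_mem_trigSubmodule (abs_le.2 (by push_cast; omega))
  exact hmul (Submodule.mul_mem_mul hf hg)

theorem norm_fourier_apply (m : ℤ) (x : UnitAddCircle) : ‖fourier m x‖ = 1 :=
  Circle.norm_coe _

theorem fourier_apply_add (m : ℤ) (x y : UnitAddCircle) :
    fourier m (x + y) = fourier m x * fourier m y := by
  simp only [fourier_apply, smul_add, AddCircle.toCircle_add, Circle.coe_mul]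

theorem exists_entire_extension (hf : f ∈ trigSubmodule L) (x : UnitAddCircle) :
    ∃ F : ℂ → ℂ, Differentiable ℂ F ∧ (∀ t : ℝ, F t = f (x + t)) ∧
      ∀ z, ‖F z‖ ≤ ‖f‖ * exp (2 * π * L * |z.im|) := by
  obtain ⟨c, hc⟩ := mem_trigSubmodule_iff.1 hf
  let F : ℂ → ℂ := fun z ↦
    ∑ m ∈ Icc (-(L : ℤ)) L, c m * fourier m x * Complex.exp (2 * π * Complex.I * m * z)
  have hF_real (t : ℝ) : F t = f (x + t) := by
    simp only [F, hc, fourier_apply_add, fourier_coe_apply, Complex.ofReal_one, div_one, mul_assoc]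
  have hF_diff : Differentiable ℂ F := by fun_prop
  have hF_le (z : ℂ) :
      ‖F z‖ ≤ (∑ m ∈ Icc (-(L : ℤ)) L, ‖c m‖) * exp (2 * π * L * |z.im|) := by
    rw [sum_mul]
    refine norm_sum_le_of_le _ fun m hm ↦ ?_
    have hre : (2 * π * Complex.I * m * z).re = -(2 * π * (m * z.im)) := by
      simp
      ring
    have hm_abs : |(m : ℝ)| ≤ L := by
      rw [mem_Icc] at hm
      exact_mod_cast abs_le.2 hm
    have hmz : -(m * z.im) ≤ L * |z.im| :=
      calc -(m * z.im) ≤ |m * z.im| := neg_le_abs _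
        _ = |(m : ℝ)| * |z.im| := abs_mul _ _
        _ ≤ L * |z.im| := by gcongr
    rw [norm_mul, norm_mul, norm_fourier_apply, mul_one, Complex.norm_exp, hre, ← mul_neg,
      mul_assoc (2 * π)]
    gcongr
  refine ⟨F, hF_diff, hF_real, norm_le_mul_exp_abs_im hF_diff hF_le fun t ↦ ?_⟩
  rw [hF_real]
  exact f.norm_coe_le_norm _

end TrigonometricPolynomials

/-- The first-order jet of `f` at `x`: `f` has value `a` and derivative `b` there. The derivative
is that of `t ↦ f (x + t)` at `0`, so that no lift of `x` to `ℝ` has to be chosen. -/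
structure HasJetAt (f : C(UnitAddCircle, ℂ)) (x : UnitAddCircle) (a b : ℂ) : Prop where
  apply_eq : f x = a
  hasDerivAt : HasDerivAt (fun t : ℝ ↦ f (x + t)) b 0

namespace HasJetAt

variable {f g : C(UnitAddCircle, ℂ)} {x : UnitAddCircle} {a b a' b' : ℂ}

theorem one (x : UnitAddCircle) : HasJetAt 1 x 1 0 :=
  ⟨rfl, hasDerivAt_const 0 1⟩

theorem add (hf : HasJetAt f x a b) (hg : HasJetAt g x a' b') :
    HasJetAt (f + g) x (a + a') (b + b') where
  apply_eq := by rw [ContinuousMap.add_apply, hf.apply_eq, hg.apply_eq]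
  hasDerivAt := hf.hasDerivAt.add hg.hasDerivAt

theorem smul (c : ℂ) (hf : HasJetAt f x a b) : HasJetAt (c • f) x (c * a) (c * b) where
  apply_eq := by rw [ContinuousMap.smul_apply, hf.apply_eq, smul_eq_mul]
  hasDerivAt := hf.hasDerivAt.const_smul c

theorem mul (hf : HasJetAt f x a b) (hg : HasJetAt g x a' b') :
    HasJetAt (f * g) x (a * a') (b * a' + a * b') where
  apply_eq := by rw [ContinuousMap.mul_apply, hf.apply_eq, hg.apply_eq]
  hasDerivAt := by
    have h := hf.hasDerivAt.mul hg.hasDerivAt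
    simp only [AddCircle.coe_zero, add_zero, hf.apply_eq, hg.apply_eq] at h
    exact h

theorem sum {ι : Type*} (S : Finset ι) {f : ι → C(UnitAddCircle, ℂ)} {a b : ι → ℂ}
    (h : ∀ i ∈ S, HasJetAt (f i) x (a i) (b i)) :
    HasJetAt (∑ i ∈ S, f i) x (∑ i ∈ S, a i) (∑ i ∈ S, b i) where
  apply_eq := by
    rw [ContinuousMap.sum_apply]
    exact sum_congr rfl fun i hi ↦ (h i hi).apply_eq
  hasDerivAt := by
    simpa only [ContinuousMap.sum_apply] using HasDerivAt.fun_sum fun i hi ↦ (h i hi).hasDerivAt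

theorem fourier (m : ℤ) (x : UnitAddCircle) :
    HasJetAt (_root_.fourier m) x (_root_.fourier m x)
      (2 * π * Complex.I * m * _root_.fourier m x) where
  apply_eq := rfl
  hasDerivAt := by
    have h := (hasDerivAt_fourier (1 : ℝ) m 0).const_mul (_root_.fourier m x)
    refine (h.congr_deriv ?_).congr_of_eventuallyEq
      (.of_forall fun t ↦ fourier_apply_add m x t)
    simp only [AddCircle.coe_zero, fourier_eval_zero, Complex.ofReal_one, div_one, mul_one]
    ring

theorem of_extension {F : ℂ → ℂ} (hF : DifferentiableAt ℂ F 0) (hFf : ∀ t : ℝ, F t = f (x + t)) :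
    HasJetAt f x (f x) (deriv F 0) where
  apply_eq := rfl
  hasDerivAt := by
    simpa only [← hFf] using! hF.hasDerivAt.comp_ofReal (z := 0)

theorem unique (hf : HasJetAt f x a b) (hf' : HasJetAt f x a' b') : b = b' :=
  hf.hasDerivAt.unique hf'.hasDerivAt

end HasJetAt

section Bernstein

variable {L : ℕ} {f : C(UnitAddCircle, ℂ)} {x : UnitAddCircle} {a b : ℂ}

theorem exists_hasJetAt (hf : f ∈ trigSubmodule L) (x : UnitAddCircle) :
    ∃ b, HasJetAt f x (f x) b := by
  obtain ⟨F, hF, hFf, -⟩ := exists_entire_extension hf x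
  exact ⟨_, .of_extension (hF 0) hFf⟩

theorem HasJetAt.norm_deriv_le (h : HasJetAt f x a b) (hf : f ∈ trigSubmodule L) (hL : 0 < L) :
    ‖b‖ ≤ ‖f‖ * exp 1 * (2 * π * L) := by
  obtain ⟨F, hF, hFf, hF_le⟩ := exists_entire_extension hf x
  rw [h.unique (.of_extension (hF 0) hFf)]
  simpa using norm_iteratedDeriv_ofReal_le hF (by positivity) hF_le 1 0

theorem HasJetAt.norm_add_coe_sub_sub_le (h : HasJetAt f x a b) (hf : f ∈ trigSubmodule L)
    (hL : 0 < L) (t : ℝ) :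
    ‖f (x + t) - a - b * t‖ ≤ 2 * (‖f‖ * exp 1) * (2 * π * L) ^ 2 * t ^ 2 := by
  obtain ⟨F, hF, hFf, hF_le⟩ := exists_entire_extension hf x
  have hF' : Differentiable ℂ (deriv F) := hF.deriv
  have hF''_le (r : ℝ) : ‖deriv (deriv F) r‖ ≤ 2 * (‖f‖ * exp 1) * (2 * π * L) ^ 2 := by
    simpa [iteratedDeriv_succ] using norm_iteratedDeriv_ofReal_le hF (by positivity) hF_le 2 r
  have key := norm_sub_sub_smul_le_mul_sq (fun r ↦ (hF r).hasDerivAt.comp_ofReal)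
    (fun r ↦ (hF' r).hasDerivAt.comp_ofReal) hF''_le 0 t
  have hF_zero : F 0 = f x := by simpa using hFf 0
  rw [h.unique (.of_extension (hF 0) hFf), ← h.apply_eq]
  simpa [hFf, hF_zero, mul_comm] using key

end Bernstein

section SeparatedPoints

theorem coe_signedRep (x : UnitAddCircle) : (signedRep x : UnitAddCircle) = x :=
  AddCircle.coe_equivIoc

theorem abs_signedRep_le (x : UnitAddCircle) : |signedRep x| ≤ 1 / 2 := by
  have h := (AddCircle.equivIoc (1 : ℝ) (-(1 / 2)) x).2
  exact abs_le.2 ⟨h.1.le, h.2.trans_eq (by norm_num)⟩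

theorem abs_signedRep (x : UnitAddCircle) : |signedRep x| = ‖x‖ := by
  have h := (AddCircle.norm_coe_eq_abs_iff (1 : ℝ) one_ne_zero).2
    (by simpa using abs_signedRep_le x)
  rw [← h, coe_signedRep]

theorem card_filter_floor_abs_div_eq_le_two {ι : Type*} {r : ι → ℝ} {δ : ℝ} (hδ : 0 < δ)
    (hr : Pairwise fun i k ↦ δ ≤ |r i - r k|) (S : Finset ι) (m : ℕ) :
    #{i ∈ S | ⌊|r i| / δ⌋₊ = m} ≤ 2 := by
  have hbin {i : ι} (hi : ⌊|r i| / δ⌋₊ = m) : m * δ ≤ |r i| ∧ |r i| < (m + 1) * δ := by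
    rwa [Nat.floor_eq_iff (by positivity), le_div_iff₀ hδ, div_lt_iff₀ hδ] at hi
  have hinj : Set.InjOn (fun i ↦ decide (0 ≤ r i)) {i ∈ S | ⌊|r i| / δ⌋₊ = m} := by
    rintro i ⟨-, hi⟩ k ⟨-, hk⟩ hik
    by_contra hne
    have hsep := hr hne
    have hsign : |r i - r k| = |(|r i| - |r k|)| := by
      rw [decide_eq_decide] at hik
      rcases le_or_gt 0 (r i) with h | h
      · rw [abs_of_nonneg h, abs_of_nonneg (hik.1 h)]
      · rw [abs_of_neg h, abs_of_neg (not_le.1 (mt hik.2 h.not_ge)), neg_sub_neg, abs_sub_comm]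
    have hclose : |(|r i| - |r k|)| < δ :=
      abs_sub_lt_iff.2 ⟨by linarith [hbin hi, hbin hk], by linarith [hbin hi, hbin hk]⟩
    exact (hsep.trans_eq hsign).not_gt hclose
  calc #{i ∈ S | ⌊|r i| / δ⌋₊ = m} ≤ #(univ : Finset Bool) :=
        card_le_card_of_injOn _ (fun _ _ ↦ mem_univ _) (by simpa using hinj)
    _ = 2 := rfl

variable {ι : Type*} {s : ι → UnitAddCircle} {δ : ℝ}

theorem card_filter_floor_norm_sub_div_eq_le_two (hδ : 0 < δ)
    (hs : Pairwise fun i k ↦ δ ≤ dist (s i) (s k)) (x : UnitAddCircle) (S : Finset ι) (m : ℕ) :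
    #{i ∈ S | ⌊‖x - s i‖ / δ⌋₊ = m} ≤ 2 := by
  have hr : Pairwise fun i k ↦ δ ≤ |signedRep (x - s i) - signedRep (x - s k)| := by
    intro i k hik
    calc δ ≤ dist (s k) (s i) := hs hik.symm
      _ = ‖((signedRep (x - s i) - signedRep (x - s k) : ℝ) : UnitAddCircle)‖ := by
        rw [AddCircle.coe_sub, coe_signedRep, coe_signedRep, sub_sub_sub_cancel_left,
          dist_eq_norm]
      _ ≤ |signedRep (x - s i) - signedRep (x - s k)| := QuotientAddGroup.norm_mk_le_norm
  simpa only [abs_signedRep] using card_filter_floor_abs_div_eq_le_two hδ hr S m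

theorem sum_floor_norm_sub_div_le_two_mul {φ : ℕ → ℝ} {Φ : ℝ} (hφ : ∀ m, 0 ≤ φ m)
    (hΦ : HasSum φ Φ) (hδ : 0 < δ) (hs : Pairwise fun i k ↦ δ ≤ dist (s i) (s k))
    (x : UnitAddCircle) (S : Finset ι) : ∑ i ∈ S, φ ⌊‖x - s i‖ / δ⌋₊ ≤ 2 * Φ := by
  calc ∑ i ∈ S, φ ⌊‖x - s i‖ / δ⌋₊
      = ∑ m ∈ S.image fun i ↦ ⌊‖x - s i‖ / δ⌋₊, #{i ∈ S | ⌊‖x - s i‖ / δ⌋₊ = m} • φ m :=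
        sum_comp _ _
    _ ≤ ∑ m ∈ S.image fun i ↦ ⌊‖x - s i‖ / δ⌋₊, 2 • φ m := by
        gcongr with m
        · exact hφ m
        · exact card_filter_floor_norm_sub_div_eq_le_two hδ hs x S m
    _ = 2 * ∑ m ∈ S.image fun i ↦ ⌊‖x - s i‖ / δ⌋₊, φ m := by
        rw [← smul_sum, nsmul_eq_mul, Nat.cast_ofNat]
    _ ≤ 2 * Φ := by
        gcongr
        exact sum_le_hasSum _ (fun m _ ↦ hφ m) hΦ

end SeparatedPoints

section FejerKernel

/-- The Fejér kernel of order `N`, normalised to take the value `1` at the origin. -/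
noncomputable def fejerKernel (N : ℕ) (y : UnitAddCircle) : ℝ :=
  ‖(N : ℂ)⁻¹ * ∑ l ∈ range N, fourier (l : ℤ) y‖ ^ 2

theorem fejerKernel_nonneg (N : ℕ) (y : UnitAddCircle) : 0 ≤ fejerKernel N y :=
  sq_nonneg _

theorem fejerKernel_zero {N : ℕ} (hN : 0 < N) : fejerKernel N 0 = 1 := by
  simp [fejerKernel, hN.ne']

theorem fejerKernel_le_one (N : ℕ) (y : UnitAddCircle) : fejerKernel N y ≤ 1 := by
  refine pow_le_one₀ (norm_nonneg _) ?_
  rw [norm_mul, norm_inv, Complex.norm_natCast]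
  refine inv_mul_le_one_of_le₀ ?_ N.cast_nonneg
  calc ‖∑ l ∈ range N, fourier (l : ℤ) y‖ ≤ ∑ l ∈ range N, ‖fourier (l : ℤ) y‖ := norm_sum_le _ _
    _ = N := by simp only [norm_fourier_apply, sum_const, card_range, nsmul_one]

theorem four_mul_norm_le_norm_fourier_sub_one (y : UnitAddCircle) :
    4 * ‖y‖ ≤ ‖fourier 1 y - 1‖ := by
  obtain ⟨t, ht, rfl, hty⟩ : ∃ t : ℝ, |t| ≤ 1 / 2 ∧ (t : UnitAddCircle) = y ∧ |t| = ‖y‖ :=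
    ⟨signedRep y, abs_signedRep_le y, coe_signedRep y, abs_signedRep y⟩
  have hsin : 2 * |t| ≤ |sin (π * t)| := by
    have h : 2 / π * |π * t| ≤ |sin (π * t)| := by
      apply mul_abs_le_abs_sin
      rw [abs_mul, abs_of_pos pi_pos, ← mul_one_div]
      gcongr
    rwa [abs_mul, abs_of_pos pi_pos, ← mul_assoc, div_mul_cancel₀ _ pi_ne_zero] at h
  have hexp : fourier 1 (t : UnitAddCircle) = Complex.exp (Complex.I * (2 * π * t : ℝ)) := by
    rw [fourier_coe_apply]
    push_cast
    ring_nf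
  rw [hexp, Complex.norm_exp_I_mul_ofReal_sub_one, mul_assoc, mul_div_cancel_left₀ _ two_ne_zero,
    norm_mul, norm_two, norm_eq_abs, ← hty]
  linarith

theorem fejerKernel_mul_sq_le_one (N : ℕ) (y : UnitAddCircle) :
    fejerKernel N y * (2 * N * ‖y‖) ^ 2 ≤ 1 := by
  set w : ℂ := fourier 1 y
  have hpow (l : ℕ) : fourier (l : ℤ) y = w ^ l := by
    simp [w, fourier_apply, AddCircle.toCircle_nsmul]
  have hgeom : ‖∑ l ∈ range N, w ^ l‖ * ‖w - 1‖ ≤ 2 := by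
    rw [← norm_mul, geom_sum_mul]
    refine (norm_sub_le _ _).trans_eq ?_
    rw [norm_pow, norm_fourier_apply, one_pow, norm_one, one_add_one_eq_two]
  have hsum : ‖∑ l ∈ range N, w ^ l‖ * (2 * ‖y‖) ≤ 1 := by
    have h := mul_le_mul_of_nonneg_left (four_mul_norm_le_norm_fourier_sub_one y)
      (norm_nonneg (∑ l ∈ range N, w ^ l))
    linarith
  simp only [fejerKernel, hpow, ← mul_pow]
  refine pow_le_one₀ (by positivity) ?_
  calc ‖(N : ℂ)⁻¹ * ∑ l ∈ range N, w ^ l‖ * (2 * N * ‖y‖)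
      = (N : ℝ)⁻¹ * N * (‖∑ l ∈ range N, w ^ l‖ * (2 * ‖y‖)) := by
        rw [norm_mul, norm_inv, Complex.norm_natCast]
        ring
    _ ≤ 1 := mul_le_one₀ inv_mul_le_one (by positivity) hsum

/-- `x ↦ fejerKernel N (x - s)` as a continuous complex-valued function. -/
noncomputable def translatedFejer (N : ℕ) (s : UnitAddCircle) : C(UnitAddCircle, ℂ) where
  toFun x := fejerKernel N (x - s)
  continuous_toFun := by
    unfold fejerKernel
    fun_prop

theorem translatedFejer_apply (N : ℕ) (s x : UnitAddCircle) :
    translatedFejer N s x = fejerKernel N (x - s) :=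
  rfl

theorem fejerKernel_eq_sum_fourier (N : ℕ) (y : UnitAddCircle) :
    (fejerKernel N y : ℂ) =
      (N : ℂ)⁻¹ ^ 2 * ∑ l ∈ range N, ∑ l' ∈ range N, fourier ((l : ℤ) - l') y := by
  rw [fejerKernel, Complex.ofReal_pow, ← Complex.mul_conj', map_mul, map_sum, map_inv₀,
    Complex.conj_natCast, mul_mul_mul_comm, ← pow_two, sum_mul_sum]
  simp only [← fourier_neg, ← fourier_add, sub_eq_add_neg]

theorem translatedFejer_mem_trigSubmodule (N : ℕ) (s : UnitAddCircle) :
    translatedFejer N s ∈ trigSubmodule (N - 1) := by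
  have h : translatedFejer N s = (N : ℂ)⁻¹ ^ 2 • ∑ l ∈ range N, ∑ l' ∈ range N,
      fourier ((l : ℤ) - l') (-s) • fourier ((l : ℤ) - l') := by
    ext x
    simp only [translatedFejer_apply, fejerKernel_eq_sum_fourier, sub_eq_add_neg x,
      fourier_apply_add, ContinuousMap.smul_apply, ContinuousMap.sum_apply, smul_eq_mul,
      mul_comm (fourier _ x)]
  rw [h]
  refine Submodule.smul_mem _ _ <| Submodule.sum_mem _ fun l hl ↦
    Submodule.sum_mem _ fun l' hl' ↦ Submodule.smul_mem _ _ (fourier_mem_trigSubmodule ?_)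
  rw [mem_range] at hl hl'
  exact abs_le.2 (by omega)

variable {ι : Type*} {s : ι → UnitAddCircle} {δ : ℝ} {N : ℕ}

theorem fejerKernel_le_inv_floor_sq (hN : 0 < N) (hδ : 0 < δ) {y : UnitAddCircle}
    (hy : δ ≤ ‖y‖) :
    fejerKernel N y ≤ (2 * N * δ)⁻¹ ^ 2 * (1 / (⌊‖y‖ / δ⌋₊ : ℝ) ^ 2) := by
  set m := ⌊‖y‖ / δ⌋₊
  have hm : 0 < m := Nat.floor_pos.2 ((one_le_div hδ).2 hy)
  have hmy : m * δ ≤ ‖y‖ := (le_div_iff₀ hδ).1 (Nat.floor_le (by positivity))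
  calc fejerKernel N y ≤ 1 / (2 * N * ‖y‖) ^ 2 := by
        rw [le_div_iff₀ (by have := hδ.trans_le hy; positivity)]
        exact fejerKernel_mul_sq_le_one N y
    _ ≤ 1 / (2 * N * (m * δ)) ^ 2 := by gcongr
    _ = (2 * N * δ)⁻¹ ^ 2 * (1 / (m : ℝ) ^ 2) := by ring

theorem sum_fejerKernel_le_of_le_norm_sub (hN : 0 < N) (hδ : 0 < δ)
    (hs : Pairwise fun i k ↦ δ ≤ dist (s i) (s k)) {x : UnitAddCircle} {S : Finset ι}
    (hx : ∀ k ∈ S, δ ≤ ‖x - s k‖) :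
    ∑ k ∈ S, fejerKernel N (x - s k) ≤ π ^ 2 / (12 * (N * δ) ^ 2) := by
  calc ∑ k ∈ S, fejerKernel N (x - s k)
      ≤ ∑ k ∈ S, (2 * N * δ)⁻¹ ^ 2 * (1 / (⌊‖x - s k‖ / δ⌋₊ : ℝ) ^ 2) :=
        sum_le_sum fun k hk ↦ fejerKernel_le_inv_floor_sq hN hδ (hx k hk)
    _ ≤ 2 * ((2 * N * δ)⁻¹ ^ 2 * (π ^ 2 / 6)) :=
        sum_floor_norm_sub_div_le_two_mul (φ := fun m ↦ (2 * N * δ)⁻¹ ^ 2 * (1 / (m : ℝ) ^ 2))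
          (fun m ↦ by positivity) (hasSum_zeta_two.mul_left _) hδ hs x S
    _ = π ^ 2 / (12 * (N * δ) ^ 2) := by ring

theorem sum_fejerKernel_le (hN : 0 < N) (hδ : 0 < δ)
    (hs : Pairwise fun i k ↦ δ ≤ dist (s i) (s k)) (x : UnitAddCircle) (S : Finset ι) :
    ∑ k ∈ S, fejerKernel N (x - s k) ≤ 2 + π ^ 2 / (12 * (N * δ) ^ 2) := by
  rw [← sum_filter_add_sum_filter_not S fun k ↦ ⌊‖x - s k‖ / δ⌋₊ = 0]
  gcongr
  · refine (sum_le_card_nsmul _ _ 1 fun k _ ↦ fejerKernel_le_one N _).trans ?_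
    rw [nsmul_one]
    exact_mod_cast card_filter_floor_norm_sub_div_eq_le_two hδ hs x S 0
  · refine sum_fejerKernel_le_of_le_norm_sub hN hδ hs fun k hk ↦ ?_
    have hfloor := Nat.pos_of_ne_zero (mem_filter.1 hk).2
    exact (one_le_div hδ).1 (Nat.floor_pos.1 hfloor)

theorem norm_sum_le_of_norm_apply_le_fejerKernel {A : ℝ} {S : Finset ι}
    {g : ι → C(UnitAddCircle, ℂ)} (hN : 0 < N) (hδ : 0 < δ)
    (hs : Pairwise fun i k ↦ δ ≤ dist (s i) (s k)) (hA : 0 ≤ A)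
    (hg : ∀ k ∈ S, ∀ x, ‖g k x‖ ≤ A * fejerKernel N (x - s k)) :
    ‖∑ k ∈ S, g k‖ ≤ A * (2 + π ^ 2 / (12 * (N * δ) ^ 2)) := by
  refine (ContinuousMap.norm_le _ (by positivity)).2 fun x ↦ ?_
  rw [ContinuousMap.sum_apply]
  calc ‖∑ k ∈ S, g k x‖ ≤ ∑ k ∈ S, A * fejerKernel N (x - s k) :=
        norm_sum_le_of_le _ fun k hk ↦ hg k hk x
    _ = A * ∑ k ∈ S, fejerKernel N (x - s k) := (mul_sum _ _ _).symm
    _ ≤ A * (2 + π ^ 2 / (12 * (N * δ) ^ 2)) := by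
        gcongr
        exact sum_fejerKernel_le hN hδ hs x S

end FejerKernel

section Interpolation

open Matrix

theorem exists_mulVec_eq_of_sum_row_le {ι 𝕜 : Type*} [Fintype ι] [DecidableEq ι] [NormedField 𝕜]
    {A : Matrix ι ι 𝕜} {q : ℝ} (hq : q < 1) (hdiag : ∀ i, A i i = 1)
    (hrow : ∀ i, ∑ k ∈ univ.erase i, ‖A i k‖ ≤ q) (v : ι → 𝕜) :
    ∃ α, A *ᵥ α = v ∧ ‖α‖ ≤ ‖v‖ / (1 - q) := by
  have hdet : A.det ≠ 0 := det_ne_zero_of_sum_row_lt_diag fun i ↦ by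
    rw [hdiag, norm_one]
    exact (hrow i).trans_lt hq
  obtain ⟨α, hα⟩ : ∃ α, A *ᵥ α = v :=
    ⟨A⁻¹ *ᵥ v, by rw [mulVec_mulVec, mul_nonsing_inv _ hdet.isUnit, one_mulVec]⟩
  refine ⟨α, hα, ?_⟩
  rcases isEmpty_or_nonempty ι with _ | ⟨⟨i₀⟩⟩
  · simp [Subsingleton.elim α 0, Subsingleton.elim v 0]
  have hq0 : 0 ≤ q := (sum_nonneg fun _ _ ↦ norm_nonneg _).trans (hrow i₀)
  have hα_le : ‖α‖ ≤ ‖v‖ + q * ‖α‖ := by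
    refine (pi_norm_le_iff_of_nonneg (by positivity)).2 fun i ↦ ?_
    have hi : α i = v i - ∑ k ∈ univ.erase i, A i k * α k := by
      rw [← hα, mulVec, dotProduct, ← add_sum_erase _ _ (mem_univ i), hdiag, one_mul,
        add_sub_cancel_right]
    rw [hi]
    refine (norm_sub_le _ _).trans (add_le_add (norm_le_pi_norm v i) ?_)
    calc ‖∑ k ∈ univ.erase i, A i k * α k‖ ≤ ∑ k ∈ univ.erase i, ‖A i k‖ * ‖α‖ := by
          refine norm_sum_le_of_le _ fun k _ ↦ ?_
          rw [norm_mul]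
          gcongr
          exact norm_le_pi_norm α k
      _ ≤ q * ‖α‖ := by
          rw [← sum_mul]
          gcongr
          exact hrow i
  rw [le_div_iff₀ (sub_pos.2 hq)]
  linarith

theorem exists_hasJetAt_zero_one {n : ℕ} (hn : 0 < n) (x₀ : UnitAddCircle) :
    ∃ τ ∈ trigSubmodule n, HasJetAt τ x₀ 0 1 ∧ ‖τ‖ ≤ 1 / (π * n) := by
  have hinv : fourier (n : ℤ) (-x₀) * fourier (n : ℤ) x₀ = (1 : ℂ) := by
    rw [← fourier_apply_add, neg_add_cancel, fourier_eval_zero]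
  set c : ℂ := 2 * π * Complex.I * n
  have hc : c ≠ 0 := by simp [c, pi_ne_zero, hn.ne']
  refine ⟨c⁻¹ • (fourier (n : ℤ) (-x₀) • fourier (n : ℤ) + (-1 : ℂ) • 1), ?_, ?_, ?_⟩
  · exact Submodule.smul_mem _ _ (Submodule.add_mem _
      (Submodule.smul_mem _ _ (fourier_mem_trigSubmodule (by simp)))
      (Submodule.smul_mem _ _ (one_mem_trigSubmodule n)))
  · convert (((HasJetAt.fourier n x₀).smul (fourier (n : ℤ) (-x₀))).add
      ((HasJetAt.one x₀).smul (-1))).smul c⁻¹ using 1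
    · rw [hinv]
      ring
    · rw [mul_left_comm (fourier (n : ℤ) (-x₀)), hinv]
      rw [Int.cast_natCast, mul_one, mul_zero, add_zero, inv_mul_cancel₀ hc]
  · have hnorm : ‖fourier (n : ℤ) (-x₀) • fourier (n : ℤ) +
        (-1 : ℂ) • (1 : C(UnitAddCircle, ℂ))‖ ≤ 2 := by
      refine (norm_add_le _ _).trans_eq ?_
      rw [norm_smul, norm_smul, norm_fourier_apply, fourier_norm]
      norm_num
    calc ‖c⁻¹ • (fourier (n : ℤ) (-x₀) • fourier (n : ℤ) + (-1 : ℂ) • 1)‖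
        ≤ (2 * π * n)⁻¹ * 2 := by
          rw [norm_smul, norm_inv]
          gcongr
          simp [c, abs_of_pos pi_pos]
      _ = 1 / (π * n) := by
          field_simp

theorem exists_hasJetAt_of_apply_eq_one {P : C(UnitAddCircle, ℂ)} {D n L : ℕ} {x₀ : UnitAddCircle}
    (hP : P ∈ trigSubmodule D) (hPx₀ : P x₀ = 1) (hn : 0 < n) (hL : D + n ≤ L) (a b : ℂ) :
    ∃ g ∈ trigSubmodule L, HasJetAt g x₀ a b ∧
      (∀ y, HasJetAt P y 0 0 → HasJetAt g y 0 0) ∧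
      ∀ x, ‖g x‖ ≤ ‖P x‖ * (‖a‖ + (‖b‖ + ‖a‖ * (‖P‖ * exp 1 * (2 * π * L))) / (π * n)) := by
  obtain ⟨τ, hτ_mem, hτ, hτ_le⟩ := exists_hasJetAt_zero_one hn x₀
  obtain ⟨d, hd⟩ := exists_hasJetAt hP x₀
  have hd_le := hd.norm_deriv_le (trigSubmodule_mono (by omega) hP) (by omega : 0 < L)
  rw [hPx₀] at hd
  refine ⟨P * (a • 1 + (b - a * d) • τ), trigSubmodule_mono hL (mul_mem_trigSubmodule hP ?_),
    ?_, fun y hy ↦ ?_, fun x ↦ ?_⟩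
  · exact Submodule.add_mem _ (Submodule.smul_mem _ _ (one_mem_trigSubmodule n))
      (Submodule.smul_mem _ _ hτ_mem)
  · convert hd.mul (((HasJetAt.one x₀).smul a).add (hτ.smul (b - a * d))) using 1 <;> ring
  · obtain ⟨e, he⟩ := exists_hasJetAt hτ_mem y
    simpa using hy.mul (((HasJetAt.one y).smul a).add (he.smul (b - a * d)))
  · rw [ContinuousMap.mul_apply, norm_mul]
    gcongr
    calc ‖a * 1 + (b - a * d) * τ x‖ ≤ ‖a‖ + (‖b‖ + ‖a‖ * ‖d‖) * ‖τ x‖ := by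
          rw [mul_one, ← norm_mul a]
          refine (norm_add_le _ _).trans ?_
          rw [norm_mul (b - a * d)]
          gcongr
          exact norm_sub_le _ _
      _ ≤ ‖a‖ + (‖b‖ + ‖a‖ * (‖P‖ * exp 1 * (2 * π * L))) * (1 / (π * n)) := by
          gcongr
          exact (τ.norm_coe_le_norm x).trans hτ_le
      _ = _ := by rw [mul_one_div]

variable {ι : Type*} {s : ι → UnitAddCircle} {δ q : ℝ} {N n L : ℕ}

theorem exists_lagrange_norm_le [Finite ι] (hN : 0 < N) (hδ : 0 < δ)
    (hs : Pairwise fun i k ↦ δ ≤ dist (s i) (s k)) (hq : q < 1)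
    (hNq : π ^ 2 / (12 * (N * δ) ^ 2) ≤ q) (j : ι) :
    ∃ G ∈ trigSubmodule (N - 1), G (s j) = 1 ∧ (∀ k ≠ j, G (s k) = 0) ∧
      ‖G‖ ≤ (2 + q) / (1 - q) := by
  classical
  cases nonempty_fintype ι
  obtain ⟨α, hα, hα_le⟩ := exists_mulVec_eq_of_sum_row_le
    (A := .of fun i k ↦ translatedFejer N (s k) (s i)) hq
    (fun i ↦ by simp [translatedFejer_apply, fejerKernel_zero hN])
    (fun i ↦ by
      simp only [of_apply, translatedFejer_apply, Complex.norm_real,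
        norm_of_nonneg (fejerKernel_nonneg _ _)]
      refine (sum_fejerKernel_le_of_le_norm_sub hN hδ hs fun k hk ↦ ?_).trans hNq
      rw [← dist_eq_norm]
      exact hs (ne_of_mem_erase hk).symm)
    (Pi.single j 1)
  rw [Pi.norm_single, norm_one] at hα_le
  have hG (i : ι) : (∑ k, α k • translatedFejer N (s k)) (s i) = (Pi.single j 1 : ι → ℂ) i := by
    simp [← hα, mulVec, dotProduct, mul_comm]
  refine ⟨∑ k, α k • translatedFejer N (s k), Submodule.sum_mem _ fun k _ ↦
    Submodule.smul_mem _ _ (translatedFejer_mem_trigSubmodule N (s k)), by simp [hG],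
    fun k hk ↦ by simp [hG, hk], ?_⟩
  have : 0 < 1 - q := sub_pos.2 hq
  calc ‖∑ k, α k • translatedFejer N (s k)‖
      ≤ 1 / (1 - q) * (2 + π ^ 2 / (12 * (N * δ) ^ 2)) := by
        refine norm_sum_le_of_norm_apply_le_fejerKernel hN hδ hs (by positivity) fun k _ x ↦ ?_
        rw [ContinuousMap.smul_apply, norm_smul, translatedFejer_apply, Complex.norm_real,
          norm_of_nonneg (fejerKernel_nonneg _ _)]
        gcongr
        · exact fejerKernel_nonneg _ _
        · exact (norm_le_pi_norm α k).trans hα_le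
    _ ≤ 1 / (1 - q) * (2 + q) := by gcongr
    _ = (2 + q) / (1 - q) := by ring

theorem exists_bump_le_fejerKernel [Finite ι] (hN : 0 < N) (hδ : 0 < δ)
    (hs : Pairwise fun i k ↦ δ ≤ dist (s i) (s k)) (hq : q < 1)
    (hNq : π ^ 2 / (12 * (N * δ) ^ 2) ≤ q) (hn : 0 < n) (j : ι) :
    ∃ P ∈ trigSubmodule (N - 1 + (N - 1 + (n - 1))), P (s j) = 1 ∧
      (∀ k ≠ j, HasJetAt P (s k) 0 0) ∧
      ∀ x, ‖P x‖ ≤ ((2 + q) / (1 - q)) ^ 2 * fejerKernel n (x - s j) := by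
  obtain ⟨G, hG_mem, hGj, hGk, hG_le⟩ := exists_lagrange_norm_le hN hδ hs hq hNq j
  have hK_mem := translatedFejer_mem_trigSubmodule n (s j)
  refine ⟨G * (G * translatedFejer n (s j)),
    mul_mem_trigSubmodule hG_mem (mul_mem_trigSubmodule hG_mem hK_mem), ?_, fun k hk ↦ ?_,
    fun x ↦ ?_⟩
  · simp [hGj, translatedFejer_apply, fejerKernel_zero hn]
  · obtain ⟨d, hd⟩ := exists_hasJetAt hG_mem (s k)
    obtain ⟨e, he⟩ := exists_hasJetAt hK_mem (s k)
    rw [hGk k hk] at hd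
    simpa using hd.mul (hd.mul he)
  · have hGx := (G.norm_coe_le_norm x).trans hG_le
    rw [ContinuousMap.mul_apply, ContinuousMap.mul_apply, norm_mul, norm_mul,
      translatedFejer_apply, Complex.norm_real, norm_of_nonneg (fejerKernel_nonneg _ _),
      ← mul_assoc, ← pow_two]
    gcongr
    exact fejerKernel_nonneg _ _

theorem exists_hermite_interpolation [Fintype ι] (hN : 0 < N) (hδ : 0 < δ)
    (hs : Pairwise fun i k ↦ δ ≤ dist (s i) (s k)) (hq : q < 1)
    (hNq : π ^ 2 / (12 * (N * δ) ^ 2) ≤ q) (hn : 0 < n)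
    (hL : N - 1 + (N - 1 + (n - 1)) + n ≤ L) (a b : ι → ℂ) :
    ∃ f ∈ trigSubmodule L, (∀ j, HasJetAt f (s j) (a j) (b j)) ∧
      ‖f‖ ≤ ((2 + q) / (1 - q)) ^ 2 *
        (‖a‖ + (‖b‖ + ‖a‖ * (((2 + q) / (1 - q)) ^ 2 * exp 1 * (2 * π * L))) / (π * n)) *
        (2 + π ^ 2 / (12 * (n * δ) ^ 2)) := by
  classical
  choose P hP_mem hPj hPk hP_le using exists_bump_le_fejerKernel hN hδ hs hq hNq hn
  choose g hg_mem hgj hgk hg_le using fun j ↦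
    exists_hasJetAt_of_apply_eq_one (hP_mem j) (hPj j) hn hL (a j) (b j)
  have hP_norm (j : ι) : ‖P j‖ ≤ ((2 + q) / (1 - q)) ^ 2 :=
    (ContinuousMap.norm_le _ (sq_nonneg _)).2 fun x ↦ (hP_le j x).trans <|
      mul_le_of_le_one_right (sq_nonneg _) (fejerKernel_le_one _ _)
  refine ⟨∑ j, g j, Submodule.sum_mem _ fun j _ ↦ hg_mem j, fun k ↦ ?_, ?_⟩
  · have hjet : ∀ j ∈ univ, HasJetAt (g j) (s k) (if j = k then a k else 0)
        (if j = k then b k else 0) := by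
      intro j _
      split_ifs with hjk
      · exact hjk ▸ hgj j
      · exact hgk j _ (hPk j k (Ne.symm hjk))
    simpa using HasJetAt.sum univ hjet
  · refine norm_sum_le_of_norm_apply_le_fejerKernel hn hδ hs (by positivity) fun j _ x ↦ ?_
    rw [mul_right_comm]
    refine (hg_le j x).trans ?_
    have hK := fejerKernel_nonneg n (x - s j)
    gcongr ?_ * (?_ + (?_ + ?_ * (?_ * exp 1 * (2 * π * L))) / (π * n))
    · exact hP_le j x
    · exact norm_le_pi_norm a j
    · exact norm_le_pi_norm b j
    · exact norm_le_pi_norm a j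
    · exact hP_norm j

end Interpolation

section MinimumSeparation

theorem pi_sq_div_twelve_mul_sq_le {B c r : ℝ} (hc : 0 < c) (hr : c ≤ r)
    (hB : 3.15 ^ 2 ≤ B * (12 * c ^ 2)) :
    π ^ 2 / (12 * r ^ 2) ≤ B :=
  calc π ^ 2 / (12 * r ^ 2) ≤ 3.15 ^ 2 / (12 * c ^ 2) := by
        gcongr
        exact pi_lt_d2.le
    _ ≤ B := (div_le_iff₀ (by positivity)).2 hB

-- `N ≈ 0.46 M` makes `π² / (12 (2 N / M)²) < 0.98`, so that the Fejér matrix is diagonally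
-- dominant, and `n ≈ 0.02 M` fits into the remaining degrees, since `2 N + 2 n ≈ 0.96 M`.
theorem exists_interpolation_degrees {M : ℕ} (hM : 0 < M) :
    ∃ N n : ℕ, 0 < N ∧ 0 < n ∧ N - 1 + (N - 1 + (n - 1)) + n ≤ M ∧
      0.92 ≤ N * (2 / (M : ℝ)) ∧ 0.04 ≤ n * (2 / (M : ℝ)) := by
  obtain ⟨N, hN, hN_lt⟩ : ∃ N : ℕ, 46 * M ≤ 100 * N ∧ 100 * (N - 1) < 46 * M :=
    ⟨(46 * M + 99) / 100, by omega, by omega⟩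
  obtain ⟨n, hn, hn_lt⟩ : ∃ n : ℕ, M ≤ 50 * n ∧ 50 * (n - 1) < M :=
    ⟨(M + 49) / 50, by omega, by omega⟩
  have hN' : 46 * (M : ℝ) ≤ 100 * N := mod_cast hN
  have hn' : (M : ℝ) ≤ 50 * n := mod_cast hn
  refine ⟨N, n, by omega, by omega, by omega, ?_, ?_⟩ <;>
  · rw [mul_div_assoc', le_div_iff₀ (by positivity)]
    linarith

theorem exists_hermite_interpolation_of_two_div_le_dist :
    ∃ K : ℝ, 0 < K ∧ ∀ M : ℕ, 0 < M → ∀ (ι : Type*) [Fintype ι] (s : ι → UnitAddCircle),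
      (Pairwise fun j k ↦ 2 / (M : ℝ) ≤ dist (s j) (s k)) → ∀ a b : ι → ℂ,
        ∃ f ∈ trigSubmodule M, (∀ j, HasJetAt f (s j) (a j) (b j)) ∧
          ‖f‖ ≤ K * (‖a‖ + (M : ℝ)⁻¹ * ‖b‖) := by
  set A : ℝ := 1 + 100 * exp 1 * 149 ^ 2 with hA
  refine ⟨149 ^ 2 * A * 520, by positivity, fun M hM ι _ s hs a b ↦ ?_⟩
  have hM' : (0 : ℝ) < M := mod_cast hM
  obtain ⟨N, n, hN, hn, hL, hNδ, hnδ⟩ := exists_interpolation_degrees hM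
  obtain ⟨f, hf_mem, hf, hf_le⟩ := exists_hermite_interpolation (q := 0.98) hN (by positivity) hs
    (by norm_num) (pi_sq_div_twelve_mul_sq_le (by norm_num) hNδ (by norm_num)) hn hL a b
  refine ⟨f, hf_mem, hf, hf_le.trans ?_⟩
  have hΛ : (2 + 0.98 : ℝ) / (1 - 0.98) = 149 := by norm_num
  have hn_ge : M / 50 ≤ (n : ℝ) := by
    rw [mul_div_assoc', le_div_iff₀ hM'] at hnδ
    linarith
  have hbump : π ^ 2 / (12 * (n * (2 / (M : ℝ))) ^ 2) ≤ 518 :=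
    pi_sq_div_twelve_mul_sq_le (by norm_num) hnδ (by norm_num)
  have hA_ge : 50 / π ≤ A := by
    have hπ : 50 / π ≤ 50 := div_le_self (by norm_num) (by linarith [pi_gt_three])
    linarith [one_le_exp zero_le_one]
  rw [hΛ]
  calc 149 ^ 2 * (‖a‖ + (‖b‖ + ‖a‖ * (149 ^ 2 * exp 1 * (2 * π * M))) / (π * n)) *
        (2 + π ^ 2 / (12 * (n * (2 / (M : ℝ))) ^ 2))
      ≤ 149 ^ 2 * (‖a‖ + (‖b‖ + ‖a‖ * (149 ^ 2 * exp 1 * (2 * π * M))) / (π * (M / 50))) *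
        (2 + 518) := by gcongr
    _ = 149 ^ 2 * (A * ‖a‖ + 50 / π * ((M : ℝ)⁻¹ * ‖b‖)) * 520 := by
        rw [hA]
        field_simp
        ring
    _ ≤ 149 ^ 2 * (A * ‖a‖ + A * ((M : ℝ)⁻¹ * ‖b‖)) * 520 := by gcongr
    _ = 149 ^ 2 * A * 520 * (‖a‖ + (M : ℝ)⁻¹ * ‖b‖) := by ring

end MinimumSeparation

theorem proposition3_general :
    ∃ C : ℝ, 0 < C ∧
      ∀ M : ℕ, 0 < M →
      ∀ (ι : Type*) [Fintype ι] (s : ι → UnitAddCircle),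
      (Pairwise fun j k ↦ 2 / (M : ℝ) ≤ dist (s j) (s k)) →
      ∀ a b : ι → ℂ,
        ∃ f ∈ trigPoly M,
          ‖f‖ ≤ C * (‖a‖ + (M : ℝ)⁻¹ * ‖b‖) ∧
          ∀ (j : ι) (x : UnitAddCircle),
            ‖f x - a j - b j * (signedRep (x - s j) : ℂ)‖
              ≤ C * ((M : ℝ) ^ 2 * ‖a‖ + (M : ℝ) * ‖b‖) * dist x (s j) ^ 2 := by
  obtain ⟨K, hK, hermite⟩ := exists_hermite_interpolation_of_two_div_le_dist
  refine ⟨8 * π ^ 2 * exp 1 * K, by positivity, fun M hM ι _ s hs a b ↦ ?_⟩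
  obtain ⟨f, hf_mem, hf, hf_le⟩ := hermite M hM ι s hs a b
  refine ⟨f, mem_trigSubmodule_iff.1 hf_mem, hf_le.trans ?_, fun j x ↦ ?_⟩
  · have hone : 1 ≤ 8 * π ^ 2 * exp 1 := by
      nlinarith [pi_gt_three, one_le_exp zero_le_one]
    gcongr
    exact le_mul_of_one_le_left hK.le hone
  · have hx : s j + signedRep (x - s j) = x := by rw [coe_signedRep, add_sub_cancel]
    have h := (hf j).norm_add_coe_sub_sub_le hf_mem hM (signedRep (x - s j))
    rw [hx, ← sq_abs (signedRep _), abs_signedRep, ← dist_eq_norm x] at h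
    refine h.trans ?_
    calc 2 * (‖f‖ * exp 1) * (2 * π * M) ^ 2 * dist x (s j) ^ 2
        ≤ 2 * (K * (‖a‖ + (M : ℝ)⁻¹ * ‖b‖) * exp 1) * (2 * π * M) ^ 2 * dist x (s j) ^ 2 := by
          gcongr
      _ = 8 * π ^ 2 * exp 1 * K * ((M : ℝ) ^ 2 * ‖a‖ + (M : ℝ) * ‖b‖) * dist x (s j) ^ 2 := by
          field_simp
          ring

theorem proposition3 :
    ∃ C : ℝ, 0 < C ∧
      ∀ M : ℕ, 128 ≤ M →
      ∀ (J : ℕ) (s : Fin J → UnitAddCircle), MinSeparation M s →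
      ∀ a b : Fin J → ℂ,
        ∃ f ∈ trigPoly M,
          ‖f‖ ≤ C * (‖a‖ + (M : ℝ)⁻¹ * ‖b‖) ∧
          ∀ j : Fin J, ∀ x ∈ nbhd M s j,
            ‖f x - a j - b j * (signedRep (x - s j) : ℂ)‖
              ≤ C * ((M : ℝ) ^ 2 * ‖a‖ + (M : ℝ) * ‖b‖) * dist x (s j) ^ 2 := by
  obtain ⟨C, hC, h⟩ := proposition3_general
  refine ⟨C, hC, fun M hM J s hs a b ↦ ?_⟩
  obtain ⟨f, hf, hf_le, hf_jet⟩ := h M (by omega) (Fin J) s (fun j k ↦ hs j k) a b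
  exact ⟨f, hf, hf_le, fun j x _ ↦ hf_jet j x⟩
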